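/- Let $\mathbb S$ be the set of all strictly decreasing sequences $s=(s_n)_{n\ge 1}$ of positive reals converging to $0$. For $S,S'\subseteq\mathbb S$ write $S'\le S$ if for every $s\in S$ there is $s'\in S'$ with $s'_n\le s_n$ for all $n$, and $S'\equiv S$ if $S'\le S$ and $S\le S'$. The set $S$ is called countably determined if there is a countable $S'\subseteq\mathbb S$ with $S'\equiv S$. A metric space $K$ is called $S$-dominated if for each $s\in S$ there is a sequence $(E_n)_{n\ge1}$ of subsets of $K$ covering $K$ with $\operatorname{diam}E_n<s_n$ for all $n\ge 1$. Let $\mathcal K_{\mathsf{GH}}$ be the space of all (isometry classes of) nonempty compact metric spaces, equipped with the Gromov–Hausdorff metric. **Theorem.** If $S\subseteq\mathbb S$ is countably determined, then a typical $K\in\mathcal K_{\mathsf{GH}}$ is $S$-dominated; that is, the set of all $S$-dominated $K\in\mathcal K_{\mathsf{GH}}$ is comeager in $\mathcal K_{\mathsf{GH}}$ (its complement is a countable union of nowhere dense sets). -/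

import Mathlib

open Set Filter Topology

namespace DominatedSets

/-- The family of all strictly decreasing sequences, indexed by the positive integers,
of positive reals converging to `0`. -/
def decreasingSeqs : Set (ℕ+ → ℝ) :=
  {s | (∀ n, 0 < s n) ∧ StrictAnti s ∧ Tendsto s atTop (𝓝 0)}

/-- `S' ≤ S`: every `s ∈ S` lies pointwise above some `s' ∈ S'`. -/
def FamilyLE (S' S : Set (ℕ+ → ℝ)) : Prop :=
  ∀ s ∈ S, ∃ s' ∈ S', ∀ n, s' n ≤ s n

/-- `S' ≡ S`: both `S' ≤ S` and `S ≤ S'`. -/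
def FamilyEquiv (S' S : Set (ℕ+ → ℝ)) : Prop :=
  FamilyLE S' S ∧ FamilyLE S S'

/-- `S` is countably determined if some countable family `S'` of strictly decreasing positive
sequences converging to `0` satisfies `S' ≡ S`. -/
def CountablyDetermined (S : Set (ℕ+ → ℝ)) : Prop :=
  ∃ S' ⊆ decreasingSeqs, S'.Countable ∧ FamilyEquiv S' S

/-- A sequence of sets is `s`-fine if `diam (E n) < s n` for all `n`. The diameter is the
extended one, so that sets of infinite diameter are never allowed. -/
def IsFine {X : Type*} [MetricSpace X] (s : ℕ+ → ℝ) (E : ℕ+ → Set X) : Prop :=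
  ∀ n, Metric.ediam (E n) < ENNReal.ofReal (s n)

/-- `A` is `S`-dominated if for each `s ∈ S` there is an `s`-fine cover of `A`. -/
def IsDominated {X : Type*} [MetricSpace X] (S : Set (ℕ+ → ℝ)) (A : Set X) : Prop :=
  ∀ s ∈ S, ∃ E : ℕ+ → Set X, IsFine s E ∧ A ⊆ ⋃ n, E n

/-- Whether a space is dominated depends only on its isometry class, so for a point of the
Gromov–Hausdorff space it may be tested on any representative. -/
theorem isDominated_univ_iff_of_isometryEquiv {X Y : Type*} [MetricSpace X] [MetricSpace Y]
    (e : X ≃ᵢ Y) (S : Set (ℕ+ → ℝ)) :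
    IsDominated S (univ : Set X) ↔ IsDominated S (univ : Set Y) := by
  constructor
  · intro h s hs
    obtain ⟨E, hE, hc⟩ := h s hs
    refine ⟨fun n => e '' E n, fun n => ?_, fun y _ => ?_⟩
    · rw [e.isometry.ediam_image]
      exact hE n
    · obtain ⟨n, hn⟩ := mem_iUnion.1 (hc (mem_univ (e.symm y)))
      exact mem_iUnion.2 ⟨n, e.symm y, hn, e.apply_symm_apply y⟩
  · intro h s hs
    obtain ⟨E, hE, hc⟩ := h s hs
    refine ⟨fun n => e.symm '' E n, fun n => ?_, fun x _ => ?_⟩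
    · rw [e.symm.isometry.ediam_image]
      exact hE n
    · obtain ⟨n, hn⟩ := mem_iUnion.1 (hc (mem_univ (e x)))
      exact mem_iUnion.2 ⟨n, e x, hn, e.symm_apply_apply x⟩

end DominatedSets

/-!
Finite metric spaces are dense in the Gromov–Hausdorff space. If `X` is finite, then every compact
space `Y` sufficiently close to `X` maps to `X` with small fibres, and giving each of the finitely
many fibres its own index `n` produces an `s`-fine cover of `Y` as soon as the fibres are smaller
than the finitely many values `s n` involved. So for each `s` the spaces with an `s`-fine cover
contain a dense open set, and a countable family of sequences `s` costs only a countable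
intersection.
-/

namespace DominatedSets

open GromovHausdorff

section

variable {X : Type*} [MetricSpace X] {A : Set X}

theorem IsDominated.of_familyLE {S S' : Set (ℕ+ → ℝ)} (h : IsDominated S' A)
    (hle : FamilyLE S' S) : IsDominated S A := by
  intro s hs
  obtain ⟨s', hs', hs's⟩ := hle s hs
  obtain ⟨E, hE, hAE⟩ := h s' hs'
  exact ⟨E, fun n => (hE n).trans_le (ENNReal.ofReal_le_ofReal (hs's n)), hAE⟩

theorem isDominated_singleton {s : ℕ+ → ℝ} :
    IsDominated {s} A ↔ ∃ E : ℕ+ → Set X, IsFine s E ∧ A ⊆ ⋃ n, E n := by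
  simp only [IsDominated, mem_singleton_iff, forall_eq]

theorem isDominated_iff_forall_singleton {S : Set (ℕ+ → ℝ)} :
    IsDominated S A ↔ ∀ s ∈ S, IsDominated {s} A := by
  simp only [IsDominated, mem_singleton_iff, forall_eq]

theorem isDominated_singleton_of_injective {ι : Type*} {s : ℕ+ → ℝ} (hs : ∀ n, 0 < s n)
    {e : ι → ℕ+} (he : e.Injective) {U : ι → Set X}
    (hU : ∀ i, Metric.ediam (U i) < ENNReal.ofReal (s (e i))) (hA : A ⊆ ⋃ i, U i) :
    IsDominated {s} A := by
  refine isDominated_singleton.2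
    ⟨Function.extend e U fun _ => ∅, fun n => ?_, hA.trans (iUnion_subset fun i => ?_)⟩
  · by_cases hn : ∃ i, e i = n
    · obtain ⟨i, rfl⟩ := hn
      rw [he.extend_apply]
      exact hU i
    · rw [Function.extend_apply' _ _ _ hn, Metric.ediam_empty]
      exact ENNReal.ofReal_pos.2 (hs n)
  · exact subset_iUnion_of_subset (e i) (he.extend_apply U _ i).ge

end

theorem exists_pos_forall_isDominated_singleton_of_ediam_le {s : ℕ+ → ℝ} (hs : ∀ n, 0 < s n)
    (ι : Type*) [Finite ι] :
    ∃ δ > 0, ∀ (X : Type*) [MetricSpace X] (A : Set X) (U : ι → Set X),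
      (∀ i, Metric.ediam (U i) ≤ ENNReal.ofReal δ) → A ⊆ ⋃ i, U i → IsDominated {s} A := by
  obtain ⟨e, he⟩ := Countable.exists_injective_nat ι
  have he' : (Nat.succPNat ∘ e).Injective := Nat.succPNat_injective.comp he
  obtain ⟨δ, hδs, hδ⟩ : ∃ δ, (∀ i, δ < s (Nat.succPNat (e i))) ∧ 0 < δ :=
    ((eventually_all.2 fun i => eventually_nhdsWithin_of_eventually_nhds
      (eventually_lt_nhds (hs _))).and self_mem_nhdsWithin).exists (f := 𝓝[>] (0 : ℝ))
  refine ⟨δ, hδ, fun X _ A U hU hA => isDominated_singleton_of_injective hs he' (fun i => ?_) hA⟩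
  exact (hU i).trans_lt ((ENNReal.ofReal_lt_ofReal_iff (hs _)).2 (hδs i))

theorem exists_map_abs_dist_sub_dist_lt_of_ghDist_lt {X Y : Type*}
    [MetricSpace X] [CompactSpace X] [Nonempty X] [MetricSpace Y] [CompactSpace Y] [Nonempty Y]
    {ε : ℝ} (h : ghDist X Y < ε) :
    ∃ f : Y → X, ∀ y y', |dist (f y) (f y') - dist y y'| < 2 * ε := by
  let Φ := optimalGHInjl X Y
  let Ψ := optimalGHInjr X Y
  have hΦ : Isometry Φ := isometry_optimalGHInjl X Y
  have hΨ : Isometry Ψ := isometry_optimalGHInjr X Y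
  have hfin : Metric.hausdorffEDist (range Φ) (range Ψ) ≠ ⊤ :=
    Metric.hausdorffEDist_ne_top_of_nonempty_of_bounded (range_nonempty _) (range_nonempty _)
      (isCompact_range hΦ.continuous).isBounded (isCompact_range hΨ.continuous).isBounded
  have hnear : ∀ y, ∃ x, dist (Φ x) (Ψ y) < ε := fun y => by
    rw [← hausdorffDist_optimal] at h
    obtain ⟨_, ⟨x, rfl⟩, hx⟩ :=
      Metric.exists_dist_lt_of_hausdorffDist_lt' (mem_range_self y) h hfin
    exact ⟨x, hx⟩
  choose f hf using hnear
  refine ⟨f, fun y y' => ?_⟩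
  rw [← hΦ.dist_eq, ← hΨ.dist_eq, ← Real.dist_eq]
  exact (dist_dist_dist_le _ _ _ _).trans_lt (by linarith [hf y, hf y'])

theorem exists_pos_forall_ghDist_lt_isDominated {s : ℕ+ → ℝ} (hs : ∀ n, 0 < s n)
    (X : Type*) [MetricSpace X] [Nonempty X] [Finite X] :
    ∃ δ > 0, ∀ (Y : Type*) [MetricSpace Y] [CompactSpace Y] [Nonempty Y],
      ghDist X Y < δ → IsDominated {s} (univ : Set Y) := by
  obtain ⟨δ, hδ, hdom⟩ := exists_pos_forall_isDominated_singleton_of_ediam_le hs X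
  refine ⟨δ / 2, half_pos hδ, fun Y _ _ _ hXY => ?_⟩
  obtain ⟨f, hf⟩ := exists_map_abs_dist_sub_dist_lt_of_ghDist_lt hXY
  refine hdom Y univ (fun x => f ⁻¹' {x}) (fun x => ?_) fun y _ => mem_iUnion.2 ⟨f y, rfl⟩
  refine Metric.ediam_le_of_forall_dist_le fun y hy y' hy' => ?_
  have hyy' : dist (f y) (f y') = 0 := by
    rw [mem_singleton_iff.1 hy, mem_singleton_iff.1 hy', dist_self]
  linarith [(abs_lt.1 (hf y y')).1]

theorem surjective_toGHSpace :
    Function.Surjective fun p : TopologicalSpace.NonemptyCompacts (lp (fun _ : ℕ => ℝ) ⊤) =>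
      toGHSpace p :=
  fun K => K.inductionOn fun p => ⟨p, eq_toGHSpace.symm⟩

theorem dense_setOf_finite_rep : Dense {K : GHSpace | Finite K.Rep} := by
  refine (surjective_toGHSpace.denseRange.dense_image toGHSpace_continuous
    TopologicalSpace.NonemptyCompacts.dense_setOfPred_finite).mono ?_
  rintro _ ⟨p, hp, rfl⟩
  have : Finite p := hp
  obtain ⟨e⟩ := toGHSpace_eq_toGHSpace_iff_isometryEquiv.1 (toGHSpace p).toGHSpace_rep
  exact Finite.of_equiv p e.symm.toEquiv

theorem isDominated_singleton_mem_residual {s : ℕ+ → ℝ} (hs : ∀ n, 0 < s n) :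
    {K : GHSpace | IsDominated {s} (univ : Set K.Rep)} ∈ residual GHSpace := by
  refine mem_of_superset (residual_of_dense_open isOpen_interior
    (dense_setOf_finite_rep.mono fun K (_ : Finite K.Rep) => ?_)) interior_subset
  obtain ⟨δ, hδ, hdom⟩ := exists_pos_forall_ghDist_lt_isDominated hs K.Rep
  refine mem_interior_iff_mem_nhds.2 (Metric.mem_nhds_iff.2 ⟨δ, hδ, fun L hL => hdom L.Rep ?_⟩)
  rwa [← dist_ghDist, ← Metric.mem_ball']

end DominatedSets

open DominatedSets GromovHausdorff in
theorem mainTheorem11_general {S S' : Set (ℕ+ → ℝ)} (hcount : S'.Countable)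
    (hpos : ∀ s ∈ S', ∀ n, 0 < s n) (hle : FamilyLE S' S) :
    {K : GHSpace | IsDominated S (univ : Set K.Rep)} ∈ residual GHSpace := by
  have hS' : ∀ᶠ K : GHSpace in residual GHSpace, ∀ s ∈ S', IsDominated {s} (univ : Set K.Rep) :=
    (eventually_countable_ball hcount).2 fun s hs => isDominated_singleton_mem_residual (hpos s hs)
  exact hS'.mono fun K hK => (isDominated_iff_forall_singleton.2 hK).of_familyLE hle

theorem mainTheorem11 (S : Set (ℕ+ → ℝ)) (hS : S ⊆ DominatedSets.decreasingSeqs)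
    (hcd : DominatedSets.CountablyDetermined S) :
    {K : GromovHausdorff.GHSpace |
      DominatedSets.IsDominated S (Set.univ : Set K.Rep)} ∈ residual GromovHausdorff.GHSpace := by
  obtain ⟨S', hS', hcount, hle, -⟩ := hcd
  exact mainTheorem11_general hcount (fun s hs => (hS' hs).1) hle
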